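/- Let $n,p\ge 1$ be integers, let $S=\{e\in\mathbb{R}^n : \|e\|=1\}$ be the Euclidean unit sphere with surface measure $ds$ (counting measure on $\{-1,1\}$ if $n=1$) and total surface area $\Omega_n$. A function $f:\mathbb{R}^{n\times p}\to\mathbb{R}\cup\{\infty\}$ is called matrix superharmonic if it is lower semicontinuous, is not identically $\infty$, and satisfies $$\frac{1}{\Omega_n}\int_{S} f(X+e\rho^{\top})\,ds(e)\;\le\; f(X)\qquad\text{for every } X\in\mathbb{R}^{n\times p}\text{ and every }\rho\in\mathbb{R}^p .$$ For a $C^2$ function $f:\mathbb{R}^{n\times p}\to\mathbb{R}$, the matrix Laplacian $\widetilde{\Delta}f(X)\in\mathbb{R}^{p\times p}$ is defined by $$(\widetilde{\Delta}f(X))_{ij}=\sum_{a=1}^{n}\frac{\partial^2 f}{\partial X_{ai}\,\partial X_{aj}}(X),\qquad 1\le i,j\le p .$$ **Theorem.** A $C^2$ function $f:\mathbb{R}^{n\times p}\to\mathbb{R}$ is matrix superharmonic if and only if $\widetilde{\Delta}f(X)$ is negative semidefinite for every $X\in\mathbb{R}^{n\times p}$. -/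

import Mathlib

open MeasureTheory

/- Matrices carry the Frobenius norm. -/
attribute [local instance] Matrix.frobeniusNormedAddCommGroup Matrix.frobeniusNormedSpace

/-- The surface measure of the Euclidean unit sphere of `ℝⁿ` (its total mass is `Ωₙ`). -/
noncomputable def sphereSurface (n : ℕ) :
    Measure (Metric.sphere (0 : EuclideanSpace ℝ (Fin n)) 1) :=
  (volume : Measure (EuclideanSpace ℝ (Fin n))).toSphere

/-- The average `(1 / Ωₙ) ∫ g ds` over the unit sphere of `ℝⁿ` of an extended-real-valued function:
the average of the positive part minus the average of the negative part. For a lower semicontinuous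
`g` that omits the value `-∞`, the second average is finite, so that the difference is
meaningful. -/
noncomputable def sphereAverage {n : ℕ}
    (g : Metric.sphere (0 : EuclideanSpace ℝ (Fin n)) 1 → EReal) : EReal :=
  ((⨍⁻ e, (g e).toENNReal ∂(sphereSurface n) : ENNReal) : EReal) -
    ((⨍⁻ e, (-g e).toENNReal ∂(sphereSurface n) : ENNReal) : EReal)

/-- `L(f : X, ρ)`, the average of `f` over the rank-one sphere `{X + e ρᵀ : ‖e‖ = 1}`. -/
noncomputable def rankOneSphereAverage {n p : ℕ} (f : Matrix (Fin n) (Fin p) ℝ → EReal)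
    (X : Matrix (Fin n) (Fin p) ℝ) (ρ : Fin p → ℝ) : EReal :=
  sphereAverage (n := n) fun e => f (X + Matrix.vecMulVec (fun a => e.1 a) ρ)

/-- A function from matrices to `ℝ ∪ {∞}` (the extended reals without `-∞`) is matrix superharmonic
if it is lower semicontinuous, is not identically `∞`, and its average over each rank-one sphere
centred at `X` is at most its value at `X`. -/
structure IsMatrixSuperharmonic {n p : ℕ} (f : Matrix (Fin n) (Fin p) ℝ → EReal) : Prop where
  ne_bot : ∀ X, f X ≠ ⊥
  lowerSemicontinuous : LowerSemicontinuous f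
  not_identically_top : ∃ X, f X ≠ ⊤
  average_le : ∀ (X : Matrix (Fin n) (Fin p) ℝ) (ρ : Fin p → ℝ), rankOneSphereAverage f X ρ ≤ f X

/-- The partial derivative `∂f/∂X_{ai}`. -/
noncomputable def matrixPartial {n p : ℕ} (a : Fin n) (i : Fin p)
    (f : Matrix (Fin n) (Fin p) ℝ → ℝ) : Matrix (Fin n) (Fin p) ℝ → ℝ :=
  fun X => lineDeriv ℝ f X (Matrix.single a i 1)

/-- The matrix Laplacian: the `p × p` matrix with entries `∑ₐ ∂²f / ∂X_{ai} ∂X_{aj}`. -/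
noncomputable def matrixLaplacian {n p : ℕ} (f : Matrix (Fin n) (Fin p) ℝ → ℝ)
    (X : Matrix (Fin n) (Fin p) ℝ) : Matrix (Fin p) (Fin p) ℝ :=
  Matrix.of fun i j => ∑ a : Fin n, matrixPartial a i (matrixPartial a j f) X

/-! Everything reduces to slices `g v = f (X + v ρᵀ)` on `ℝⁿ`. By the chain rule `Δ g` is the
quadratic form of the matrix Laplacian at `ρ` (`laplacian_comp_add_vecMulVecRight`), and scaling `ρ`
changes the radius of the sphere. So the claim becomes the classical one: `Δ g ≤ 0` is equivalent to
the mean value inequality on spheres.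

For the classical part, the derivative in `r` of the spherical integral of `g` is the flux `N r` of
the gradient. Instead of the divergence theorem on a ball, Green's identity is tested against `Ψ
(‖x‖ ^ 2)` with `Ψ' = -w`, where `w` is a bump near `r₀ ^ 2`. If `N r₀ > 0`, polar coordinates make
one side positive, while `Δ g ≤ 0` makes the other nonpositive (`integral_sphere_fderiv_nonpos`).
Conversely, if `Δ g 0 > 0`, the forward direction applied to `-g + c ‖x‖ ^ 2` near `0` contradicts
the mean value inequality (`laplacian_nonpos_of_integral_sphere_le`). -/

open Laplacian

/-- A `C¹` nonnegative antitone cutoff whose derivative is concentrated near `s₀`. -/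
theorem exists_cutoff_deriv_concentrated (s₀ : ℝ) {δ : ℝ} (hδ : 0 < δ) :
    ∃ w Ψ : ℝ → ℝ, Continuous w ∧ (∀ s, 0 ≤ w s) ∧ 0 < w s₀ ∧ (∀ s, δ ≤ |s - s₀| → w s = 0) ∧
      (∀ s, HasDerivAt Ψ (-w s) s) ∧ (∀ s, 0 ≤ Ψ s) ∧ ∀ s, s₀ + δ ≤ s → Ψ s = 0 := by
  let w : ℝ → ℝ := fun s => max 0 (δ - |s - s₀|)
  have hw : Continuous w := by fun_prop
  have hw0 : ∀ s, 0 ≤ w s := fun s => le_max_left _ _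
  have hz : ∀ s, δ ≤ |s - s₀| → w s = 0 := fun s hs => max_eq_left (by linarith)
  have hΨ : ∀ s, s₀ + δ ≤ s → ∫ t in s..(s₀ + δ), w t = 0 := fun s hs => by
    rw [intervalIntegral.integral_symm, neg_eq_zero]
    refine (intervalIntegral.integral_congr (g := fun _ => (0 : ℝ)) fun t ht => ?_).trans (by simp)
    rw [Set.uIcc_of_le hs] at ht
    exact hz t (by rw [abs_of_nonneg] <;> linarith [ht.1])
  -- `Ψ` is the integral of the tent `w` from `s` to `s₀ + δ`; beyond that endpoint the integral is
  -- reversed, but `w` vanishes there.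
  refine ⟨w, fun s => ∫ t in s..(s₀ + δ), w t, hw, hw0, by simp [w, hδ], hz, fun s => ?_,
    fun s => ?_, hΨ⟩
  · exact intervalIntegral.integral_hasDerivAt_left (hw.intervalIntegrable _ _)
      (hw.stronglyMeasurableAtFilter _ _) hw.continuousAt
  · rcases le_total s (s₀ + δ) with h | h
    · exact intervalIntegral.integral_nonneg h fun t _ => hw0 t
    · exact (hΨ s h).ge

/-! ### Green's identity and polar coordinates -/

section Sphere

variable {E : Type*} [NormedAddCommGroup E] [InnerProductSpace ℝ E] [FiniteDimensional ℝ E]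

theorem laplacian_eq_sum_fderiv_fderiv {ι : Type*} [Fintype ι] (b : OrthonormalBasis ι ℝ E)
    (g : E → ℝ) (x : E) : (Δ g) x = ∑ i, fderiv ℝ (fderiv ℝ g) x (b i) (b i) := by
  simp [InnerProductSpace.laplacian_eq_iteratedFDeriv_orthonormalBasis g b,
    iteratedFDeriv_two_apply]

theorem ContDiff.continuous_laplacian {g : E → ℝ} (hg : ContDiff ℝ 2 g) : Continuous (Δ g) := by
  have h : ContDiff ℝ 1 (fderiv ℝ g) := hg.fderiv_right (by norm_num)
  have h' : Continuous (fderiv ℝ (fderiv ℝ g)) := h.continuous_fderiv (by norm_num)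
  rw [funext (laplacian_eq_sum_fderiv_fderiv (stdOrthonormalBasis ℝ E) g)]
  fun_prop

theorem laplacian_norm_sq (x : E) :
    (Δ (fun y : E => ‖y‖ ^ 2)) x = (2 * Module.finrank ℝ E : ℝ) := by
  rw [laplacian_eq_sum_fderiv_fderiv (stdOrthonormalBasis ℝ E), fderiv_norm_sq]
  have h : fderiv ℝ (2 • ⇑(innerSL ℝ (E := E))) x = 2 • innerSL ℝ (E := E) :=
    (2 • innerSL ℝ (E := E)).fderiv
  have h1 : ∀ i, innerSL ℝ (stdOrthonormalBasis ℝ E i) (stdOrthonormalBasis ℝ E i) = 1 := fun i => by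
    rw [innerSL_apply_apply]
    simp
  simp [h, h1, mul_comm]

theorem hasCompactSupport_comp_norm_sq {u : ℝ → ℝ} {B : ℝ} (hu : ∀ s, B ≤ s → u s = 0) :
    HasCompactSupport fun x : E => u (‖x‖ ^ 2) := by
  refine HasCompactSupport.intro (isCompact_closedBall (0 : E) (|B| + 1)) fun x hx => hu _ ?_
  have : |B| + 1 < ‖x‖ := by simpa using hx
  nlinarith [le_abs_self B, abs_nonneg B]

variable [MeasurableSpace E] [BorelSpace E]

/-- Green's identity against a radial test function. -/
theorem integral_comp_norm_sq_mul_laplacian {g : E → ℝ} (hg : ContDiff ℝ 2 g) {w Ψ : ℝ → ℝ}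
    (hw : Continuous w) (hΨ : ∀ s, HasDerivAt Ψ (-w s) s) {B : ℝ} (hB : ∀ s, B ≤ s → Ψ s = 0) :
    ∫ x, Ψ (‖x‖ ^ 2) * (Δ g) x = ∫ x, 2 * w (‖x‖ ^ 2) * fderiv ℝ g x x := by
  let b := stdOrthonormalBasis ℝ E
  have hg1 : ContDiff ℝ 1 (fderiv ℝ g) := hg.fderiv_right (by norm_num)
  have hg2 : Continuous (fderiv ℝ (fderiv ℝ g)) := hg1.continuous_fderiv (by norm_num)
  have hg1c := hg1.continuous
  have hψ : ∀ x : E, HasFDerivAt (fun x : E => Ψ (‖x‖ ^ 2))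
      ((-w (‖x‖ ^ 2)) • (2 • innerSL ℝ x)) x := fun x =>
    (hΨ _).comp_hasFDerivAt x (hasStrictFDerivAt_norm_sq x).hasFDerivAt
  have hψc : Continuous fun x : E => Ψ (‖x‖ ^ 2) :=
    continuous_iff_continuousAt.2 fun x => (hψ x).continuousAt
  have hψs : HasCompactSupport fun x : E => Ψ (‖x‖ ^ 2) := hasCompactSupport_comp_norm_sq hB
  have hd : ∀ i x, fderiv ℝ (fun y => fderiv ℝ g y (b i)) x (b i)
      = fderiv ℝ (fderiv ℝ g) x (b i) (b i) := fun i x => by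
    rw [fderiv_clm_apply ((hg1.differentiable (by norm_num)) x) (by fun_prop)]
    simp
  have hdψ : ∀ i x, fderiv ℝ (fun x : E => Ψ (‖x‖ ^ 2)) x (b i)
      = -(2 * w (‖x‖ ^ 2) * inner ℝ x (b i)) := fun i x => by
    rw [(hψ x).fderiv]
    simp
    ring
  have hds : ∀ i, HasCompactSupport fun x => fderiv ℝ (fun x : E => Ψ (‖x‖ ^ 2)) x (b i) :=
    fun i => hψs.fderiv_apply ℝ (b i)
  have hdc : ∀ i, Continuous fun x => fderiv ℝ (fun x : E => Ψ (‖x‖ ^ 2)) x (b i) := fun i => by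
    simp only [hdψ]
    fun_prop
  have int1 : ∀ i, Integrable fun x =>
      fderiv ℝ (fun x : E => Ψ (‖x‖ ^ 2)) x (b i) * fderiv ℝ g x (b i) := fun i =>
    ((hdc i).mul (by fun_prop)).integrable_of_hasCompactSupport (hds i).mul_right
  have int2 : ∀ i, Integrable fun x : E =>
      Ψ (‖x‖ ^ 2) * fderiv ℝ (fun y => fderiv ℝ g y (b i)) x (b i) := fun i => by
    simp only [hd]
    exact (hψc.mul (by fun_prop)).integrable_of_hasCompactSupport hψs.mul_right
  have int3 : ∀ i, Integrable fun x : E => Ψ (‖x‖ ^ 2) * fderiv ℝ g x (b i) := fun i =>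
    (hψc.mul (by fun_prop)).integrable_of_hasCompactSupport hψs.mul_right
  -- Compact support of `Ψ (‖x‖ ^ 2)` removes the boundary terms.
  have key : ∀ i, ∫ x : E, Ψ (‖x‖ ^ 2) * fderiv ℝ (fun y => fderiv ℝ g y (b i)) x (b i)
      = -∫ x, fderiv ℝ (fun x : E => Ψ (‖x‖ ^ 2)) x (b i) * fderiv ℝ g x (b i) := fun i =>
    integral_mul_fderiv_eq_neg_fderiv_mul_of_integrable (int1 i) (int2 i) (int3 i)
      (fun x _ => (hψ x).differentiableAt)
      (fun x _ => ((hg1.differentiable (by norm_num)) x).clm_apply (by fun_prop))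
  calc ∫ x, Ψ (‖x‖ ^ 2) * (Δ g) x
      = ∫ x, ∑ i, Ψ (‖x‖ ^ 2) * fderiv ℝ (fun y => fderiv ℝ g y (b i)) x (b i) := by
        simp only [laplacian_eq_sum_fderiv_fderiv b, hd, Finset.mul_sum]
    _ = ∑ i, ∫ x, Ψ (‖x‖ ^ 2) * fderiv ℝ (fun y => fderiv ℝ g y (b i)) x (b i) :=
        integral_finsetSum _ fun i _ => int2 i
    _ = ∑ i, ∫ x, -(fderiv ℝ (fun x : E => Ψ (‖x‖ ^ 2)) x (b i) * fderiv ℝ g x (b i)) := by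
        simp only [key, integral_neg]
    _ = ∫ x, ∑ i, -(fderiv ℝ (fun x : E => Ψ (‖x‖ ^ 2)) x (b i) * fderiv ℝ g x (b i)) :=
        (integral_finsetSum _ fun i _ => (int1 i).neg).symm
    _ = ∫ x, 2 * w (‖x‖ ^ 2) * fderiv ℝ g x x := by
        -- The gradient of `Ψ (‖x‖ ^ 2)` is `-2 w (‖x‖ ^ 2) x`, so the coordinate terms reassemble
        -- into the derivative of `g` along `x`.
        congr with x
        have hx : fderiv ℝ g x x = ∑ i, inner ℝ x (b i) * fderiv ℝ g x (b i) := by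
          calc fderiv ℝ g x x = fderiv ℝ g x (∑ i, inner ℝ (b i) x • b i) := by rw [b.sum_repr' x]
            _ = _ := by simp only [map_sum, map_smul, smul_eq_mul, real_inner_comm]
        rw [hx, Finset.mul_sum]
        refine Finset.sum_congr rfl fun i _ => ?_
        rw [hdψ]
        ring

variable [Nontrivial E]

/-- Integration in polar coordinates. -/
theorem integral_eq_integral_Ioi_integral_sphere {F : E → ℝ} (hF : Integrable F) :
    ∫ x, F x = ∫ r in Set.Ioi (0 : ℝ), r ^ (Module.finrank ℝ E - 1) *
      ∫ e : Metric.sphere (0 : E) 1, F (r • (e : E)) ∂(volume : Measure E).toSphere := by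
  let μ : Measure E := volume
  let ν := Measure.volumeIoiPow (Module.finrank ℝ E - 1)
  let G : Metric.sphere (0 : E) 1 × Set.Ioi (0 : ℝ) → ℝ := fun p => F ((p.2 : ℝ) • (p.1 : E))
  have hG : ∀ x : ({0}ᶜ : Set E), G (homeomorphUnitSphereProd E x) = F x := fun x => by
    have := (homeomorphUnitSphereProd E).symm_apply_apply x
    conv_rhs => rw [← this]
    rfl
  have hmp := μ.measurePreserving_homeomorphUnitSphereProd
  have hemb := (homeomorphUnitSphereProd E).measurableEmbedding
  have hGi : Integrable G (μ.toSphere.prod ν) := by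
    rw [← hmp.integrable_comp_emb hemb]
    have : G ∘ homeomorphUnitSphereProd E = F ∘ Subtype.val := funext hG
    rw [this, ← integrableOn_iff_comap_subtypeVal (measurableSet_singleton _).compl]
    exact hF.integrableOn
  calc ∫ x, F x = ∫ x : ({0}ᶜ : Set E), F x ∂(μ.comap (↑)) := by
        rw [integral_subtype_comap (measurableSet_singleton _).compl F, restrict_compl_singleton]
    _ = ∫ p, G p ∂(μ.toSphere.prod ν) := by
        rw [← hmp.integral_comp hemb]
        simp only [hG]
    _ = ∫ r, ∫ e, G (e, r) ∂μ.toSphere ∂ν := integral_prod_symm _ hGi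
    _ = _ := by
        simp only [ν, Measure.volumeIoiPow, ENNReal.ofReal]
        rw [integral_withDensity_eq_integral_smul
            ((measurable_subtype_coe.pow_const _).real_toNNReal),
          integral_subtype_comap measurableSet_Ioi fun r : ℝ =>
            Real.toNNReal (r ^ (Module.finrank ℝ E - 1)) •
              ∫ e : Metric.sphere (0 : E) 1, F (r • (e : E)) ∂μ.toSphere]
        refine setIntegral_congr_fun measurableSet_Ioi fun r hr => ?_
        rw [NNReal.smul_def, Real.coe_toNNReal _ (pow_nonneg hr.out.le _), smul_eq_mul]

end Sphere

/-! ### Spherical means and the sign of the Laplacian -/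

section SphereMean

variable {E : Type*} [NormedAddCommGroup E] [InnerProductSpace ℝ E] [FiniteDimensional ℝ E]
  [MeasurableSpace E] [BorelSpace E]

theorem continuous_integral_sphere {F : ℝ → E → ℝ} (hF : Continuous F.uncurry) :
    Continuous fun r => ∫ e : Metric.sphere (0 : E) 1, F r e ∂(volume : Measure E).toSphere := by
  have : Continuous (Function.uncurry fun (r : ℝ) (e : Metric.sphere (0 : E) 1) => F r e) :=
    hF.comp (by fun_prop : Continuous fun p : ℝ × Metric.sphere (0 : E) 1 => (p.1, (p.2 : E)))
  simpa using continuous_parametric_integral_of_continuous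
    (μ := (volume : Measure E).toSphere) this isCompact_univ

theorem hasDerivAt_integral_sphere {g : E → ℝ} (hg : ContDiff ℝ 1 g) (r : ℝ) :
    HasDerivAt
      (fun r => ∫ e : Metric.sphere (0 : E) 1, g (r • (e : E)) ∂(volume : Measure E).toSphere)
      (∫ e : Metric.sphere (0 : E) 1, fderiv ℝ g (r • (e : E)) e ∂(volume : Measure E).toSphere)
      r := by
  have hgc := hg.continuous
  have hg1 : Continuous (fderiv ℝ g) := hg.continuous_fderiv (by norm_num)
  have hc : Continuous fun p : ℝ × Metric.sphere (0 : E) 1 =>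
      fderiv ℝ g (p.1 • (p.2 : E)) (p.2 : E) := by fun_prop
  -- The dominating constant comes from compactness of a radius interval times the sphere.
  obtain ⟨C, hC⟩ := ((isCompact_closedBall r 1).prod
    (isCompact_univ (X := Metric.sphere (0 : E) 1))).exists_bound_of_continuousOn hc.continuousOn
  have hint : ∀ {u : Metric.sphere (0 : E) 1 → ℝ}, Continuous u →
      Integrable u (volume : Measure E).toSphere := fun hu =>
    hu.integrable_of_hasCompactSupport (HasCompactSupport.of_compactSpace _)
  refine (hasDerivAt_integral_of_dominated_loc_of_deriv_le
    (F := fun (r : ℝ) (e : Metric.sphere (0 : E) 1) => g (r • (e : E)))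
    (F' := fun r e => fderiv ℝ g (r • (e : E)) e)
    (bound := fun _ => C) (Metric.closedBall_mem_nhds r one_pos)
    (.of_forall fun r => (hint (by fun_prop)).aestronglyMeasurable)
    (hint (by fun_prop)) (hint (hc.comp (by fun_prop : Continuous fun e => (r, e)))).1
    (.of_forall fun e s hs => hC (s, e) ⟨hs, Set.mem_univ _⟩) (integrable_const _)
    (.of_forall fun e s _ => ?_)).2
  have := (hg.differentiable (by norm_num) (s • (e : E))).hasFDerivAt.comp_hasDerivAt s
    ((hasDerivAt_id s).smul_const (e : E))
  simpa [Function.comp_def] using this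

variable [Nontrivial E]

/-- The flux of the gradient of a function superharmonic in a ball is nonpositive. -/
theorem integral_sphere_fderiv_nonpos {g : E → ℝ} (hg : ContDiff ℝ 2 g) {R : ℝ}
    (hΔ : ∀ x, ‖x‖ < R → (Δ g) x ≤ 0) {r₀ : ℝ} (hr₀ : 0 < r₀) (hr₀R : r₀ < R) :
    ∫ e : Metric.sphere (0 : E) 1, fderiv ℝ g (r₀ • (e : E)) e ∂(volume : Measure E).toSphere
      ≤ 0 := by
  by_contra! hpos
  have hg1 : Continuous (fderiv ℝ g) := hg.continuous_fderiv (by norm_num)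
  let N : ℝ → ℝ := fun r =>
    ∫ e : Metric.sphere (0 : E) 1, fderiv ℝ g (r • (e : E)) e ∂(volume : Measure E).toSphere
  have hN : Continuous N := continuous_integral_sphere (F := fun r e => fderiv ℝ g (r • e) e)
    (by simp only [Function.uncurry_def]; fun_prop)
  -- The variable is `s = r ^ 2`, the argument of the cutoff.
  have hev : ∀ᶠ s in nhds (r₀ ^ 2), 0 < N (√s) ∧ s < R ^ 2 := by
    refine Filter.Eventually.and ?_ (gt_mem_nhds (by gcongr))
    refine (hN.comp Real.continuous_sqrt).continuousAt.eventually (lt_mem_nhds ?_)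
    simpa [Real.sqrt_sq hr₀.le] using hpos
  obtain ⟨ε, hε, hball⟩ := Metric.eventually_nhds_iff.1 hev
  -- Width `ε / 2` keeps the endpoint `r₀ ^ 2 + ε / 2` strictly inside the `ε`-ball, hence below `R
  -- ^ 2`.
  obtain ⟨w, Ψ, hw, hw0, hws, hwz, hΨ, hΨ0, hΨz⟩ :=
    exists_cutoff_deriv_concentrated (r₀ ^ 2) (half_pos hε)
  have hgreen := integral_comp_norm_sq_mul_laplacian hg hw hΨ hΨz
  have hle : ∫ x : E, Ψ (‖x‖ ^ 2) * (Δ g) x ≤ 0 := by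
    refine integral_nonpos fun x => ?_
    rcases lt_or_ge (‖x‖ ^ 2) (r₀ ^ 2 + ε / 2) with h | h
    · refine mul_nonpos_of_nonneg_of_nonpos (hΨ0 _) (hΔ x ?_)
      have h1 : r₀ ^ 2 + ε / 2 < R ^ 2 := (hball (by
        rw [Real.dist_eq, abs_of_nonneg] <;> linarith)).2
      exact lt_of_pow_lt_pow_left₀ 2 (hr₀.trans hr₀R).le (h.trans h1)
    · simp [hΨz _ h]
  have hFs : HasCompactSupport fun x : E => w (‖x‖ ^ 2) :=
    hasCompactSupport_comp_norm_sq (u := w) (B := r₀ ^ 2 + ε / 2) fun s hs =>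
      hwz s (by rw [abs_of_nonneg] <;> linarith)
  have hFi : Integrable fun x : E => 2 * w (‖x‖ ^ 2) * fderiv ℝ g x x :=
    Continuous.integrable_of_hasCompactSupport (by fun_prop) (hFs.mul_left.mul_right)
  -- The radial integrand; its factor `r` comes from differentiating along `r • e` rather than `e`.
  -- Using `K |r|` gives a continuous nonnegative function on the whole line, whose integral is
  -- twice that over the half-line.
  let K : ℝ → ℝ := fun r => r ^ (Module.finrank ℝ E - 1) * (2 * w (r ^ 2) * r * N r)
  have hpolar : ∫ x : E, 2 * w (‖x‖ ^ 2) * fderiv ℝ g x x = ∫ r in Set.Ioi (0 : ℝ), K |r| := by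
    rw [integral_eq_integral_Ioi_integral_sphere hFi]
    refine setIntegral_congr_fun measurableSet_Ioi fun r hr => ?_
    simp only [K, N, abs_of_pos (Set.mem_Ioi.1 hr)]
    rw [← integral_const_mul (2 * w (r ^ 2) * r)]
    congr 1
    refine integral_congr_ae (.of_forall fun e => ?_)
    simp [norm_smul]
    ring
  have hKc : Continuous fun r : ℝ => K |r| := by
    simp only [K]
    fun_prop
  have hKs : HasCompactSupport fun r : ℝ => K |r| := by
    have h : HasCompactSupport fun r : ℝ => w (|r| ^ 2) :=
      hasCompactSupport_comp_norm_sq (E := ℝ) (B := r₀ ^ 2 + ε / 2) fun s hs =>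
        hwz s (by rw [abs_of_nonneg] <;> linarith)
    exact (((h.mul_left (f := fun _ => 2)).mul_right (f' := fun r => |r|)).mul_right
      (f' := fun r => N |r|)).mul_left (f := fun r => |r| ^ (Module.finrank ℝ E - 1))
  have hK0 : 0 ≤ fun r : ℝ => K |r| := fun r => by
    rcases le_or_gt (ε / 2) |(|r| ^ 2 - r₀ ^ 2)| with h | h
    · simp only [K, hwz _ h]
      simp
    · have h1 : 0 < N |r| := by
        have := (hball (y := |r| ^ 2) (by rw [Real.dist_eq]; linarith)).1
        rwa [Real.sqrt_sq (abs_nonneg r)] at this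
      have := hw0 (|r| ^ 2)
      simp only [K, Pi.zero_apply]
      positivity
  have hK1 : K |r₀| ≠ 0 := by
    have : 0 < N r₀ := hpos
    simp only [K, abs_of_pos hr₀]
    positivity
  have hKpos : 0 < ∫ r : ℝ, K |r| :=
    hKc.integral_pos_of_hasCompactSupport_nonneg_nonzero hKs hK0 hK1
  have habs : ∫ r : ℝ, K |r| = 2 * ∫ r in Set.Ioi (0 : ℝ), K |r| := by
    have := integral_comp_abs (f := fun r => K |r|)
    simpa using this
  linarith

/-- The spherical integral has the nonpositive flux as derivative, so it decreases from its value at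
radius `0`, where the integrand is constantly `g 0`. -/
theorem integral_sphere_le_of_laplacian_nonpos {g : E → ℝ} (hg : ContDiff ℝ 2 g) {R : ℝ}
    (hΔ : ∀ x, ‖x‖ < R → (Δ g) x ≤ 0) {r : ℝ} (hr : 0 ≤ r) (hrR : r < R) :
    ∫ e : Metric.sphere (0 : E) 1, g (r • (e : E)) ∂(volume : Measure E).toSphere
      ≤ (volume : Measure E).toSphere.real Set.univ * g 0 := by
  have hd := hasDerivAt_integral_sphere (E := E) (hg.of_le one_le_two)
  have hanti : AntitoneOn
      (fun r => ∫ e : Metric.sphere (0 : E) 1, g (r • (e : E)) ∂(volume : Measure E).toSphere)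
      (Set.Icc 0 r) := by
    refine antitoneOn_of_deriv_nonpos (convex_Icc 0 r)
      (fun s _ => (hd s).continuousAt.continuousWithinAt)
      (fun s _ => (hd s).differentiableAt.differentiableWithinAt) fun s hs => ?_
    rw [interior_Icc] at hs
    rw [(hd s).deriv]
    exact integral_sphere_fderiv_nonpos hg hΔ hs.1 (hs.2.trans hrR)
  simpa using hanti ⟨le_rfl, hr⟩ ⟨hr, le_rfl⟩ hr

/-- If the averages over all small spheres centred at `0` are at most the central value, then the
Laplacian there is nonpositive. -/
theorem laplacian_nonpos_of_integral_sphere_le {g : E → ℝ} (hg : ContDiff ℝ 2 g)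
    (hm : ∀ r : ℝ, 0 < r →
      ∫ e : Metric.sphere (0 : E) 1, g (r • (e : E)) ∂(volume : Measure E).toSphere
        ≤ (volume : Measure E).toSphere.real Set.univ * g 0) :
    (Δ g) 0 ≤ 0 := by
  by_contra! hpos
  have hn : (0 : ℝ) < Module.finrank ℝ E := by exact_mod_cast Module.finrank_pos
  -- `Δ (c ‖x‖ ^ 2) = 2 c n`; taking half the critical `c` keeps `Δ (-g + c ‖x‖ ^ 2)` negative near
  -- `0`.
  obtain ⟨c, hc, hcΔ⟩ : ∃ c : ℝ, 0 < c ∧ c * (2 * Module.finrank ℝ E) < (Δ g) 0 :=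
    ⟨(Δ g) 0 / (2 * Module.finrank ℝ E) / 2, by positivity, by field_simp; linarith⟩
  obtain ⟨ε, hε, hball⟩ := Metric.eventually_nhds_iff.1
    (hg.continuous_laplacian.continuousAt.eventually (lt_mem_nhds hcΔ))
  let q : E → ℝ := fun x => ‖x‖ ^ 2
  have hq : ContDiff ℝ 2 q := contDiff_norm_sq ℝ
  have hcq : ContDiff ℝ 2 (c • q) := contDiff_const.smul hq
  have hng : ContDiff ℝ 2 (-g) := hg.neg
  have hle := integral_sphere_le_of_laplacian_nonpos (g := -g + c • q) (hng.add hcq) (R := ε)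
    (fun x hx => by
      rw [ContDiffAt.laplacian_add hng.contDiffAt hcq.contDiffAt,
        InnerProductSpace.laplacian_neg, Pi.neg_apply,
        InnerProductSpace.laplacian_smul c hq.contDiffAt, laplacian_norm_sq]
      have := hball (y := x) (by simpa using hx)
      simp only [smul_eq_mul]
      linarith) (half_pos hε).le (half_lt_self hε)
  have hgc := hg.continuous
  have hint : Integrable (fun e : Metric.sphere (0 : E) 1 => g ((ε / 2) • (e : E)))
      (volume : Measure E).toSphere :=
    Continuous.integrable_of_hasCompactSupport (by fun_prop) (HasCompactSupport.of_compactSpace _)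
  -- The quadratic term is constant on the sphere, so the integral of `g` exceeds mass times `g 0`
  -- by at least mass times `c (ε / 2) ^ 2`.
  have heq : ∫ e : Metric.sphere (0 : E) 1, (-g + c • q) ((ε / 2) • (e : E))
        ∂(volume : Measure E).toSphere
      = -(∫ e : Metric.sphere (0 : E) 1, g ((ε / 2) • (e : E)) ∂(volume : Measure E).toSphere)
        + (volume : Measure E).toSphere.real Set.univ * (c * (ε / 2) ^ 2) := by
    have : ∀ e : Metric.sphere (0 : E) 1, (-g + c • q) ((ε / 2) • (e : E))
        = -g ((ε / 2) • (e : E)) + c * (ε / 2) ^ 2 := fun e => by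
      simp [q, norm_smul, abs_of_pos hε]
    simp only [this]
    rw [integral_add (f := fun e : Metric.sphere (0 : E) 1 => -g ((ε / 2) • (e : E))) hint.neg
      (integrable_const _), integral_neg, integral_const, smul_eq_mul]
  have hmass : 0 < (volume : Measure E).toSphere.real Set.univ :=
    have : NeZero (volume : Measure E).toSphere := ⟨Measure.toSphere_ne_zero _⟩
    measureReal_univ_pos
  have h0 : (-g + c • q) 0 = -g 0 := by simp [q]
  rw [heq, h0] at hle
  have := hm _ (half_pos hε)
  have : 0 < (volume : Measure E).toSphere.real Set.univ * (c * (ε / 2) ^ 2) := by positivity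
  linarith

end SphereMean

/-! ### Extended-real averages of real functions -/

/-- On the compact sphere both the positive and negative parts have finite integrals, so their
difference is the Bochner average. -/
theorem sphereAverage_coe {n : ℕ} (hn : 0 < n)
    {g : Metric.sphere (0 : EuclideanSpace ℝ (Fin n)) 1 → ℝ} (hg : Continuous g) :
    sphereAverage (fun e => (g e : EReal)) = ((⨍ e, g e ∂sphereSurface n : ℝ) : EReal) := by
  have : Nonempty (Fin n) := ⟨⟨0, hn⟩⟩
  have hσ : IsFiniteMeasure (sphereSurface n) := by unfold sphereSurface; infer_instance
  have hσ0 : NeZero (sphereSurface n) := ⟨Measure.toSphere_ne_zero _⟩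
  let ν := (sphereSurface n Set.univ)⁻¹ • sphereSurface n
  have hν : IsProbabilityMeasure ν := inferInstance
  have hi : Integrable g ν :=
    hg.integrable_of_hasCompactSupport (HasCompactSupport.of_compactSpace _)
  have htop : ∀ {u : Metric.sphere (0 : EuclideanSpace ℝ (Fin n)) 1 → ℝ}, Integrable u ν →
      ∫⁻ e, ENNReal.ofReal (u e) ∂ν ≠ ⊤ := fun hu => hu.lintegral_lt_top.ne
  have h1 : ∫ e, g e ∂ν = _ := integral_eq_lintegral_pos_part_sub_lintegral_neg_part hi
  have h2 : ∀ e, (-(g e : EReal)).toENNReal = ENNReal.ofReal (-g e) := fun e => by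
    rw [← EReal.coe_neg, EReal.real_coe_toENNReal]
  unfold sphereAverage laverage average
  change ((∫⁻ e, _ ∂ν : ENNReal) : EReal) - ((∫⁻ e, _ ∂ν : ENNReal) : EReal)
    = ((∫ e, g e ∂ν : ℝ) : EReal)
  simp only [h2, EReal.real_coe_toENNReal]
  rw [h1, EReal.coe_sub, EReal.coe_ennreal_toReal (htop hi),
    EReal.coe_ennreal_toReal (htop (u := fun e => -g e) hi.neg)]

/-! ### Second derivatives along affine maps -/

section SecondDerivative

variable {E F : Type*} [NormedAddCommGroup E] [InnerProductSpace ℝ E] [FiniteDimensional ℝ E]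
  [NormedAddCommGroup F] [NormedSpace ℝ F] {f : F → ℝ}

theorem lineDeriv_lineDeriv_eq_fderiv_fderiv (hf : ContDiff ℝ 2 f) (X a b : F) :
    lineDeriv ℝ (fun Y => lineDeriv ℝ f Y b) X a = fderiv ℝ (fderiv ℝ f) X a b := by
  have hf1 : ContDiff ℝ 1 (fderiv ℝ f) := hf.fderiv_right (by norm_num)
  have h1 : (fun Y => lineDeriv ℝ f Y b) = fun Y => fderiv ℝ f Y b := funext fun Y =>
    (hf.differentiable (by norm_num) Y).lineDeriv_eq_fderiv
  have h2 : DifferentiableAt ℝ (fderiv ℝ f) X := hf1.differentiable (by norm_num) X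
  rw [h1, (h2.clm_apply (differentiableAt_const b)).lineDeriv_eq_fderiv,
    fderiv_clm_apply h2 (differentiableAt_const b)]
  simp

theorem lineDeriv_lineDeriv_comm (hf : ContDiff ℝ 2 f) (X a b : F) :
    lineDeriv ℝ (fun Y => lineDeriv ℝ f Y b) X a
      = lineDeriv ℝ (fun Y => lineDeriv ℝ f Y a) X b := by
  simp only [lineDeriv_lineDeriv_eq_fderiv_fderiv hf]
  exact (hf.contDiffAt.isSymmSndFDerivAt (by simp)).eq _ _

theorem contDiff_comp_const_add_linearMap (hf : ContDiff ℝ 2 f) (X : F) (L : E →ₗ[ℝ] F) :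
    ContDiff ℝ 2 fun v => f (X + L v) :=
  hf.comp (contDiff_const.add (LinearMap.toContinuousLinearMap L).contDiff)

/-- The inner map is affine, so the Hessian pulls back with no first-order term; bilinearity then
expands it into the iterated directional derivatives used by `matrixLaplacian`. -/
theorem laplacian_comp_const_add_linearMap (hf : ContDiff ℝ 2 f) (X : F) (L : E →ₗ[ℝ] F)
    {ι κ : Type*} [Fintype ι] [Fintype κ] (b : OrthonormalBasis ι ℝ E) (V : ι → κ → F)
    (ρ : κ → ℝ) (hL : ∀ a, L (b a) = ∑ i, ρ i • V a i) (v : E) :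
    (Δ (fun v => f (X + L v))) v = ∑ a, ∑ i, ∑ j, ρ i * (ρ j *
      lineDeriv ℝ (fun Y => lineDeriv ℝ f Y (V a j)) (X + L v) (V a i)) := by
  have hg := contDiff_comp_const_add_linearMap hf X L
  have hlin : ∀ c v, lineDeriv ℝ (fun v => f (X + L v)) v c = lineDeriv ℝ f (X + L v) (L c) :=
    fun c v => by simp [lineDeriv, add_assoc]
  rw [laplacian_eq_sum_fderiv_fderiv b]
  refine Finset.sum_congr rfl fun a _ => ?_
  have h2 : fderiv ℝ (fderiv ℝ fun v => f (X + L v)) v (b a) (b a)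
      = fderiv ℝ (fderiv ℝ f) (X + L v) (L (b a)) (L (b a)) := by
    rw [← lineDeriv_lineDeriv_eq_fderiv_fderiv hg, ← lineDeriv_lineDeriv_eq_fderiv_fderiv hf]
    simp only [hlin]
    simp [lineDeriv, add_assoc]
  simp only [h2, hL, map_sum, map_smul, sum_apply, smul_apply, smul_eq_mul,
    lineDeriv_lineDeriv_eq_fderiv_fderiv hf, Finset.mul_sum]
  rw [Finset.sum_comm]
  exact Finset.sum_congr rfl fun i _ => Finset.sum_congr rfl fun j _ => by ring

end SecondDerivative

/-! ### Rank-one slices and the matrix Laplacian -/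

/-- The linear map `v ↦ v ρᵀ`. -/
def vecMulVecRight {n p : ℕ} (ρ : Fin p → ℝ) :
    EuclideanSpace ℝ (Fin n) →ₗ[ℝ] Matrix (Fin n) (Fin p) ℝ where
  toFun v := Matrix.vecMulVec (fun a => v a) ρ
  map_add' v w := by ext; simp [Matrix.vecMulVec_apply, add_mul]
  map_smul' c v := by ext; simp [Matrix.vecMulVec_apply, mul_assoc]

theorem vecMulVecRight_apply {n p : ℕ} (ρ : Fin p → ℝ) (v : EuclideanSpace ℝ (Fin n)) :
    vecMulVecRight ρ v = Matrix.vecMulVec (fun a => v a) ρ := rfl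

/-- Lets the quantifier over `ρ` supply spheres of every radius in a fixed direction. -/
theorem vecMulVecRight_smul_left {n p : ℕ} (c : ℝ) (ρ : Fin p → ℝ)
    (v : EuclideanSpace ℝ (Fin n)) :
    vecMulVecRight (c • ρ) v = vecMulVecRight ρ (c • v) := by
  ext
  simp [vecMulVecRight_apply, Matrix.vecMulVec_apply]
  ring

theorem vecMulVecRight_single {n p : ℕ} (ρ : Fin p → ℝ) (a : Fin n) :
    vecMulVecRight ρ (EuclideanSpace.single a 1) = ∑ i, ρ i • Matrix.single a i (1 : ℝ) := by
  ext b j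
  simp [vecMulVecRight_apply, Matrix.vecMulVec_apply, Matrix.sum_apply, Matrix.single_apply,
    Finset.sum_ite_eq, ite_and, eq_comm]

section MatrixLaplacian

variable {n p : ℕ} {f : Matrix (Fin n) (Fin p) ℝ → ℝ}

/-- `PosSemidef` includes symmetry, which here is the equality of mixed partials of a `C²` function.
-/
theorem isHermitian_matrixLaplacian (hf : ContDiff ℝ 2 f) (X : Matrix (Fin n) (Fin p) ℝ) :
    (matrixLaplacian f X).IsHermitian := by
  ext i j
  simp only [Matrix.conjTranspose_apply, star_trivial, matrixLaplacian, Matrix.of_apply]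
  exact Finset.sum_congr rfl fun a _ =>
    lineDeriv_lineDeriv_comm hf X (Matrix.single a j 1) (Matrix.single a i 1)

theorem laplacian_comp_add_vecMulVecRight (hf : ContDiff ℝ 2 f)
    (X : Matrix (Fin n) (Fin p) ℝ) (ρ : Fin p → ℝ) (v : EuclideanSpace ℝ (Fin n)) :
    (Δ (fun v => f (X + vecMulVecRight ρ v))) v
      = ρ ⬝ᵥ (matrixLaplacian f (X + vecMulVecRight ρ v)).mulVec ρ := by
  rw [laplacian_comp_const_add_linearMap hf X (vecMulVecRight ρ)
    (EuclideanSpace.basisFun (Fin n) ℝ) (fun a i => Matrix.single a i 1) ρ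
    (fun a => by rw [EuclideanSpace.basisFun_apply, vecMulVecRight_single])]
  simp only [dotProduct, Matrix.mulVec, matrixLaplacian, Matrix.of_apply, Finset.sum_mul,
    Finset.mul_sum]
  rw [Finset.sum_comm]
  refine Finset.sum_congr rfl fun i _ => ?_
  rw [Finset.sum_comm]
  refine Finset.sum_congr rfl fun j _ => Finset.sum_congr rfl fun a _ => ?_
  rw [mul_comm (ρ j)]
  rfl

theorem rankOneSphereAverage_coe_le_iff (hn : 0 < n) (hf : ContDiff ℝ 2 f)
    (X : Matrix (Fin n) (Fin p) ℝ) (ρ : Fin p → ℝ) :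
    rankOneSphereAverage (fun X => (f X : EReal)) X ρ ≤ f X ↔
      ∫ e : Metric.sphere (0 : EuclideanSpace ℝ (Fin n)) 1, f (X + vecMulVecRight ρ e)
          ∂(volume : Measure (EuclideanSpace ℝ (Fin n))).toSphere
        ≤ (volume : Measure (EuclideanSpace ℝ (Fin n))).toSphere.real Set.univ * f X := by
  have : Nonempty (Fin n) := ⟨⟨0, hn⟩⟩
  have : NeZero (volume : Measure (EuclideanSpace ℝ (Fin n))).toSphere :=
    ⟨Measure.toSphere_ne_zero _⟩
  have hc : Continuous fun e : Metric.sphere (0 : EuclideanSpace ℝ (Fin n)) 1 =>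
      f (X + vecMulVecRight ρ e) :=
    (contDiff_comp_const_add_linearMap hf X (vecMulVecRight ρ)).continuous.comp
      continuous_subtype_val
  have h := sphereAverage_coe hn hc
  simp only [vecMulVecRight_apply] at h ⊢
  rw [rankOneSphereAverage, h, EReal.coe_le_coe_iff, average_eq, smul_eq_mul, sphereSurface,
    inv_mul_le_iff₀ measureReal_univ_pos]

end MatrixLaplacian

/-! ### The equivalence -/

theorem mainTheorem5 {n p : ℕ} (hn : 0 < n) (f : Matrix (Fin n) (Fin p) ℝ → ℝ)
    (hf : ContDiff ℝ 2 f) :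
    IsMatrixSuperharmonic (fun X => (f X : EReal)) ↔
      ∀ X : Matrix (Fin n) (Fin p) ℝ, (-matrixLaplacian f X).PosSemidef := by
  have : Nonempty (Fin n) := ⟨⟨0, hn⟩⟩
  have hcomp : ∀ (X : Matrix (Fin n) (Fin p) ℝ) (ρ : Fin p → ℝ),
      ContDiff ℝ 2 fun v : EuclideanSpace ℝ (Fin n) => f (X + vecMulVecRight ρ v) :=
    fun X ρ => contDiff_comp_const_add_linearMap hf X _
  have hquad : ∀ X : Matrix (Fin n) (Fin p) ℝ, (-matrixLaplacian f X).PosSemidef ↔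
      ∀ ρ : Fin p → ℝ, ρ ⬝ᵥ (matrixLaplacian f X).mulVec ρ ≤ 0 := fun X => by
    rw [Matrix.posSemidef_iff_dotProduct_mulVec,
      and_iff_right (isHermitian_matrixLaplacian hf X).neg]
    simp [Matrix.neg_mulVec]
  constructor
  · intro h X
    refine (hquad X).2 fun ρ => ?_
    have := laplacian_nonpos_of_integral_sphere_le (hcomp X ρ) fun r _ => by
      have := (rankOneSphereAverage_coe_le_iff hn hf X (r • ρ)).1
        (h.average_le X (r • ρ))
      simpa only [vecMulVecRight_smul_left, map_zero, add_zero] using this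
    simpa only [laplacian_comp_add_vecMulVecRight hf, map_zero, add_zero] using this
  · intro h
    refine ⟨fun X => EReal.coe_ne_bot _, ?_, ⟨0, EReal.coe_ne_top _⟩, fun X ρ => ?_⟩
    · exact (continuous_coe_real_ereal.comp hf.continuous).lowerSemicontinuous
    · refine (rankOneSphereAverage_coe_le_iff hn hf X ρ).2 ?_
      -- The Laplacian bound holds everywhere, so any `R > 1` serves for the unit sphere.
      have := integral_sphere_le_of_laplacian_nonpos (hcomp X ρ) (R := 2) (fun v _ => by
        rw [laplacian_comp_add_vecMulVecRight hf]
        exact (hquad _).1 (h _) ρ) zero_le_one one_lt_two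
      simpa only [one_smul, map_zero, add_zero] using this
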